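/- **Definitions.** Addresses are words $\xi\in\omega^\star$; two addresses are disjoint if neither is a prefix of the other; a finite set of addresses is well formed if its elements are pairwise disjoint; $\zeta\star J=\{\zeta j: j\in J\}$. Actions are $(+,\xi,I)$ and $(-,\xi,I)$, with focus $\xi$ and $I\subseteq\omega$ finite; these two are opposite to each other. Pseudo-designs (of finite depth) are given by $$\phi::=\Omega\mid\maltese\mid(+,\xi,I)\cdot\{\psi_{\xi i}: i\in I\},\qquad \psi_\zeta::=\{(-,\zeta,J)\phi_J: J\in\mathcal P_f(\omega)\}.$$ They are typed as follows. $\Omega,\maltese:(\vdash\Gamma)$ for every well-formed $\Gamma$. If $\xi\notin\Lambda$, $\{\xi\}\cup\Lambda$ is well formed, and $\psi_{\xi i}:(\xi i\vdash\Lambda_i)$ for all $i\in I$ with the $\Lambda_i\subseteq\Lambda$ pairwise disjoint sets, then $(+,\xi,I)\cdot\{\psi_{\xi i}\}:(\vdash\xi,\Lambda)$. If $\zeta\notin\Lambda$, $\{\zeta\}\cup\Lambda$ is well formed, and $\phi_J:(\vdash\zeta\star J,\Lambda_J)$ with $\Lambda_J\subseteq\Lambda$ for all $J$, then $\psi_\zeta:(\zeta\vdash\Lambda)$.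 A design is a typable pseudo-design $\neq\Omega$; it is a slice if in each of its negative sub-pseudo-designs $\{(-,\zeta,J)\phi_J\}_J$ at most one $\phi_J$ is different from $\Omega$ (a slice of finite depth is finite). Occurrences are words over letters $i$, $I$, $1$: $(\phi)_\epsilon$ is the root of a positive $\phi$ (that is, $\Omega$, $\maltese$ or $(+,\xi,I)$); if $\phi=(+,\xi,I)\cdot\{\psi_{\xi i}\}$ then $(\phi)_{iu}=(\psi_{\xi i})_u$ for $i\in I$; if $\psi=\{(-,\zeta,J)\phi_J\}_J$ then $(\psi)_J=(-,\zeta,J)$ and $(\psi)_{J1u}=(\phi_J)_u$. The nodes of a design are the occurrences of $\maltese$, of positive actions $(+,\xi,I)$, and of those negative actions whose son is not $\Omega$. Its underlying set of actions consists of the positive and negative actions found at its nodes. The action at $u$ points to the action at $v$ if $v$ is strictly below $u$ and their foci are $\zeta i$ and $\zeta$ for some $\zeta$, $i$. Normalization of $\langle\phi\mid\psi\rangle$, for $\phi$ positive and $\psi$ negative with focus $\xi$, is the token machine. It starts with a token at $(L,\epsilon)$ and an empty set of bindings, and moves as follows ($L$: the token is in $\phi$; $R$: in $\psi$): - from $(L,\epsilon)$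 with $(\phi)_\epsilon=(+,\xi,I)$: move to $(R,I)$, add the binding $((L,\epsilon),(R,I))$; - from $(L,u)$ (resp. $(R,u)$) where the action at $u$ is negative: move to $(L,u1)$ (resp. $(R,u1)$); - from $(R,u)$ with $(\psi)_u=(+,\zeta i,I)$, where $u$ points to $v$ and $((L,v'),(R,v))$ is a binding: move to $(L,v'\,i\,I)$, add the binding $((L,v'\,i\,I),(R,u))$; - from $(L,u)$ with $(\phi)_u=(+,\zeta i,I)$, where $u$ points to $v$ and $((L,v),(R,v'))$ is a binding: move to $(R,v'\,i\,I)$, add the binding $((L,u),(R,v'\,i\,I))$. **Proposition.** Let $\phi:(\vdash\xi,\Lambda_1)$ and $\psi:(\xi\vdash\Lambda_2)$ be finite slices, where each address of $\Lambda_1$ is disjoint from each address of $\Lambda_2$. Suppose that the underlying sets of actions of $\phi$ and $\psi$ are opposite: an action occurs in $\phi$ if and only if its opposite occurs in $\psi$. Then the normalization of $\langle\phi\mid\psi\rangle$ visits all of $\phi$ and $\psi$: the token reaches $(L,u)$ for every node $u$ of $\phi$, and $(R,u)$ for every node $u$ of $\psi$. -/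

import Mathlib

namespace Ludics

/-- Addresses are words of natural numbers; `ξ ++ [i]` is the address `ξ i`. -/
abbrev Addr := List ℕ

/-- The set `ζ ⋆ J = {ζ j | j ∈ J}`. -/
def starSet (ζ : Addr) (J : Finset ℕ) : Finset Addr := J.image fun j => ζ ++ [j]

/-- Two addresses are disjoint when neither is a prefix of the other. -/
def AddrDisjoint (ξ ζ : Addr) : Prop := ¬ ξ <+: ζ ∧ ¬ ζ <+: ξ

/-- A set of addresses is well formed when its elements are pairwise disjoint addresses. -/
def WellFormed (Λ : Finset Addr) : Prop :=
  ∀ ξ ∈ Λ, ∀ ζ ∈ Λ, ξ ≠ ζ → AddrDisjoint ξ ζ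

/-- A proper action `(+, ξ, I)` or `(-, ξ, I)`: a sign, a focus and a ramification. -/
inductive Action where
  | pos (ξ : Addr) (I : Finset ℕ)
  | neg (ξ : Addr) (I : Finset ℕ)

def Action.focus : Action → Addr
  | .pos ξ _ => ξ
  | .neg ξ _ => ξ

/-- The opposite (dual) action. -/
def Action.opposite : Action → Action
  | .pos ξ I => .neg ξ I
  | .neg ξ I => .pos ξ I

/-- Positive pseudo-designs of finite depth: `Ω`, the daimon, and
`(+, ξ, I) · {ψ_{ξ i} | i ∈ I}`, where `ψ_{ξ i} = {(-, ξ i, J) φ_{i, J} | J}` with `J` ranging over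
all finite sets of natural numbers is given by its family of subtrees `φ_{i, J} = branch i J`. -/
inductive PosDesign where
  | omega
  | daimon
  | act (ξ : Addr) (I : Finset ℕ) (branch : I → Finset ℕ → PosDesign)

/-- Negative pseudo-designs `{(-, ζ, J) φ_J | J}`, with `J` ranging over all finite sets of natural
numbers; here `ζ = focus` and `φ_J = branch J`. -/
structure NegDesign where
  focus : Addr
  branch : Finset ℕ → PosDesign

/-! ### Typing -/

/-- The negative typing rule: `{(-, ζ, J) φ_J | J} : (ζ ⊢ Λ)`, where `Typed J Γ` says
`φ_J : (⊢ Γ)`. -/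
def NegRule (ζ : Addr) (Λ : Finset Addr) (Typed : Finset ℕ → Finset Addr → Prop) : Prop :=
  ζ ∉ Λ ∧ WellFormed (insert ζ Λ) ∧ ∀ J, ∃ ΛJ, ΛJ ⊆ Λ ∧ Typed J (starSet ζ J ∪ ΛJ)

/-- `φ.HasBase Γ` means `φ : (⊢ Γ)`. -/
def PosDesign.HasBase : PosDesign → Finset Addr → Prop
  | .omega, Γ => WellFormed Γ
  | .daimon, Γ => WellFormed Γ
  | .act ξ I branch, Γ =>
      ∃ Λ : Finset Addr, ξ ∉ Λ ∧ Γ = insert ξ Λ ∧ WellFormed Γ ∧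
        ∃ Λs : I → Finset Addr,
          (∀ i, Λs i ⊆ Λ) ∧ (∀ i j, i ≠ j → Disjoint (Λs i) (Λs j)) ∧
          ∀ i, NegRule (ξ ++ [i.1]) (Λs i) fun J => (branch i J).HasBase

/-- `ψ.HasBase ζ Λ` means `ψ : (ζ ⊢ Λ)`. -/
def NegDesign.HasBase (ψ : NegDesign) (ζ : Addr) (Λ : Finset Addr) : Prop :=
  ψ.focus = ζ ∧ NegRule ζ Λ fun J => (ψ.branch J).HasBase

/-- Positive designs on the base `⊢ Γ`: typable pseudo-designs other than `Ω`. -/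
def PosDesign.IsDesign (φ : PosDesign) (Γ : Finset Addr) : Prop :=
  φ ≠ .omega ∧ φ.HasBase Γ

/-- Negative designs on the base `ζ ⊢ Λ`. -/
def NegDesign.IsDesign (ψ : NegDesign) (ζ : Addr) (Λ : Finset Addr) : Prop :=
  ψ.HasBase ζ Λ

/-! ### Slices -/

/-- Among the subtrees `φ_J` of a negative pseudo-design, at most one is different from `Ω`. -/
def AtMostOneBranch (branch : Finset ℕ → PosDesign) : Prop :=
  ∀ J K, branch J ≠ .omega → branch K ≠ .omega → J = K

/-- Slices: no negative rule has two different premises. The trees here have finite depth and `I` is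
finite, so such a tree has finitely many nodes once the subtrees `Ω` are discarded. -/
def PosDesign.IsSlice : PosDesign → Prop
  | .omega => True
  | .daimon => True
  | .act _ _ branch => ∀ i, AtMostOneBranch (branch i) ∧ ∀ J, (branch i J).IsSlice

def NegDesign.IsSlice (ψ : NegDesign) : Prop :=
  AtMostOneBranch ψ.branch ∧ ∀ J, (ψ.branch J).IsSlice

/-! ### Occurrences -/

/-- Letters of occurrences: an index `i`, a ramification `I`, or `1`. -/
inductive Letter where
  | idx (i : ℕ)
  | ram (I : Finset ℕ)
  | one

abbrev Occ := List Letter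

/-- What may be found at an occurrence: `Ω`, the daimon, or a proper action. -/
inductive Label where
  | omega
  | daimon
  | action (a : Action)

/-- `φ.at u` is `(φ)_u`, or `none` when `u` is not an occurrence of `φ`. -/
def PosDesign.at : PosDesign → Occ → Option Label
  | .omega, [] => some .omega
  | .daimon, [] => some .daimon
  | .act ξ I _, [] => some (.action (.pos ξ I))
  | .act ξ I _, [.idx i, .ram J] =>
      if i ∈ I then some (.action (.neg (ξ ++ [i]) J)) else none
  | .act _ I branch, .idx i :: .ram J :: .one :: u =>
      if h : i ∈ I then (branch ⟨i, h⟩ J).at u else none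
  | _, _ => none

/-- `ψ.at u` is `(ψ)_u`, or `none` when `u` is not an occurrence of `ψ`. -/
def NegDesign.at (ψ : NegDesign) : Occ → Option Label
  | [.ram J] => some (.action (.neg ψ.focus J))
  | .ram J :: .one :: u => (ψ.branch J).at u
  | _ => none

/-- Given the labelling `at` of a pseudo-design, `u` is a node of it once the subtrees `Ω` are
discarded: a daimon, a proper positive action, or a negative action whose son is not `Ω`. -/
def IsNode (at' : Occ → Option Label) (u : Occ) : Prop :=
  match at' u with
  | some .daimon => True
  | some (.action (.pos _ _)) => True
  | some (.action (.neg _ _)) => at' (u ++ [.one]) ≠ some .omega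
  | _ => False

/-- The underlying set of actions. -/
def actions (at' : Occ → Option Label) : Set Action :=
  {a | ∃ u, IsNode at' u ∧ at' u = some (.action a)}

/-- The action at `u` points to the action at `v`: `v` is strictly below `u`, and the focus of the
former extends the focus of the latter by one letter. -/
def PointsTo (at' : Occ → Option Label) (u v : Occ) : Prop :=
  v <+: u ∧ v ≠ u ∧ ∃ (a b : Action) (i : ℕ),
    at' u = some (.action a) ∧ at' v = some (.action b) ∧ a.focus = b.focus ++ [i]

/-! ### The token machine -/

/-- The token is at an occurrence of the left design or at one of the right design. -/
inductive Token where
  | L (u : Occ)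
  | R (u : Occ)

/-- A state: the position of the token, and the set of bindings `((L, u), (R, v))`. -/
structure State where
  token : Token
  bindings : Set (Occ × Occ)

/-- The moves of the token machine normalizing `⟨φ | ψ⟩`. -/
inductive Step (φ : PosDesign) (ψ : NegDesign) : State → State → Prop
  | start (B : Set (Occ × Occ)) (I : Finset ℕ)
      (h : φ.at [] = some (.action (.pos ψ.focus I))) :
      Step φ ψ ⟨.L [], B⟩ ⟨.R [.ram I], insert ([], [.ram I]) B⟩
  | negR (B : Set (Occ × Occ)) (u : Occ) (ζ : Addr) (J : Finset ℕ)
      (h : ψ.at u = some (.action (.neg ζ J))) :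
      Step φ ψ ⟨.R u, B⟩ ⟨.R (u ++ [.one]), B⟩
  | posR (B : Set (Occ × Occ)) (u v v' : Occ) (ζ : Addr) (i : ℕ) (I : Finset ℕ)
      (h : ψ.at u = some (.action (.pos (ζ ++ [i]) I))) (hp : PointsTo ψ.at u v)
      (hB : (v', v) ∈ B) :
      Step φ ψ ⟨.R u, B⟩
        ⟨.L (v' ++ [.idx i, .ram I]), insert (v' ++ [.idx i, .ram I], u) B⟩
  | posL (B : Set (Occ × Occ)) (u v v' : Occ) (ζ : Addr) (i : ℕ) (I : Finset ℕ)
      (h : φ.at u = some (.action (.pos (ζ ++ [i]) I))) (hp : PointsTo φ.at u v)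
      (hB : (v, v') ∈ B) :
      Step φ ψ ⟨.L u, B⟩
        ⟨.R (v' ++ [.idx i, .ram I]), insert (u, v' ++ [.idx i, .ram I]) B⟩
  | negL (B : Set (Occ × Occ)) (u : Occ) (ζ : Addr) (J : Finset ℕ)
      (h : φ.at u = some (.action (.neg ζ J))) :
      Step φ ψ ⟨.L u, B⟩ ⟨.L (u ++ [.one]), B⟩

/-- The token reaches position `t` during the normalization of `⟨φ | ψ⟩`, which starts with the
token at the root of `φ` and no binding. -/
def Visits (φ : PosDesign) (ψ : NegDesign) (t : Token) : Prop :=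
  ∃ B, Relation.ReflTransGen (Step φ ψ) ⟨.L [], ∅⟩ ⟨t, B⟩

end Ludics

namespace Ludics

/-! Typing and the slice condition force the actions of each slice to have pairwise distinct foci
(`posNode_uniqueFoci`, `negNode_uniqueFoci`). An action is therefore matched with exactly one node
on the other side, and normalization can be replaced by a `Walk` without bindings: from a negative
node to its son, from a positive node to the opposite negative node. `Balanced` isolates the facts
used about the two trees.

The walk respects the tree order: it visits the predecessor of a node before the node (`walk_par`).
Suppose a node is never visited. On the path to it there is a visited positive node `v` with an
unvisited negative successor `w`; such a `v` is called stuck. The opposite `x` of `w` is unvisited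
too, since a jump from `x` would reach `w`. But `x` points to the opposite `y` of `v`, and `y` is
visited right after `v`. Hence some node between `y` and `x` is stuck, and it is visited after `y`,
so strictly later than `v` (`exists_later_stuck`). As slices have finitely many nodes, no node is
stuck (`not_stuck`), and the walk visits everything.

Finally the token machine follows the walk (`exists_run`): every visited negative node is bound to
its opposite, so the position prescribed by a binding is the node to which the walk jumps. -/

/-! ### Nodes as an inductive predicate -/

/-- Labels of positive nodes. -/
def Label.NotNeg (l : Label) : Prop := ∀ ζ J, l ≠ .action (.neg ζ J)

/-- `PosNode φ u l`: the occurrence `u` is a node of `φ`, with label `l`. -/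
inductive PosNode : PosDesign → Occ → Label → Prop
  | daimon : PosNode .daimon [] .daimon
  | root (ξ : Addr) (I : Finset ℕ) (b) : PosNode (.act ξ I b) [] (.action (.pos ξ I))
  | neg (ξ : Addr) (I : Finset ℕ) (b : I → Finset ℕ → PosDesign) (i : I) (J) (h : b i J ≠ .omega) :
      PosNode (.act ξ I b) [.idx i, .ram J] (.action (.neg (ξ ++ [i.1]) J))
  | sub (ξ : Addr) (I : Finset ℕ) (b : I → Finset ℕ → PosDesign) (i : I) (J u l) (h : PosNode (b i J) u l) :
      PosNode (.act ξ I b) (.idx i :: .ram J :: .one :: u) l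

/-- `NegNode ψ u l`: the occurrence `u` is a node of `ψ`, with label `l`. -/
inductive NegNode (ψ : NegDesign) : Occ → Label → Prop
  | root (J) (h : ψ.branch J ≠ .omega) : NegNode ψ [.ram J] (.action (.neg ψ.focus J))
  | sub (J u l) (h : PosNode (ψ.branch J) u l) : NegNode ψ (.ram J :: .one :: u) l

theorem posNode_root {φ : PosDesign} (h : φ ≠ .omega) : ∃ l, PosNode φ [] l ∧ l.NotNeg := by
  cases φ with
  | omega => exact absurd rfl h
  | daimon => exact ⟨_, .daimon, fun _ _ h => by cases h⟩
  | act ξ I b => exact ⟨_, .root ξ I b, fun _ _ h => by cases h⟩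

theorem PosNode.notNeg_of_nil {φ : PosDesign} {l : Label} (h : PosNode φ [] l) : l.NotNeg := by
  cases h <;> intro _ _ h <;> cases h

theorem PosNode.ne_omega {φ : PosDesign} {u : Occ} {l : Label} (h : PosNode φ u l) :
    φ ≠ .omega := by
  cases h <;> simp

theorem at_nil_ne_omega {φ : PosDesign} : φ.at [] ≠ some .omega ↔ φ ≠ .omega := by
  cases φ <;> simp [PosDesign.at]

theorem PosNode.at_eq {φ : PosDesign} {u : Occ} {l : Label} (h : PosNode φ u l) :
    φ.at u = some l := by
  induction h with
  | daimon => simp [PosDesign.at]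
  | root => simp [PosDesign.at]
  | neg ξ I b i J h => simp [PosDesign.at]
  | sub ξ I b i J u l h ih => simpa [PosDesign.at] using ih

theorem NegNode.at_eq {ψ : NegDesign} {u : Occ} {l : Label} (h : NegNode ψ u l) :
    ψ.at u = some l := by
  cases h with
  | root J h => simp [NegDesign.at]
  | sub J u l h => simpa [NegDesign.at] using h.at_eq

theorem PosNode.isNode {φ : PosDesign} {u : Occ} {l : Label} (h : PosNode φ u l) :
    IsNode φ.at u := by
  induction h with
  | daimon => simp [IsNode, PosDesign.at]
  | root => simp [IsNode, PosDesign.at]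
  | neg ξ I b i J h => simpa [IsNode, PosDesign.at] using at_nil_ne_omega.2 h
  | sub ξ I b i J u l h ih => simpa [IsNode, PosDesign.at] using ih

theorem NegNode.isNode {ψ : NegDesign} {u : Occ} {l : Label} (h : NegNode ψ u l) :
    IsNode ψ.at u := by
  cases h with
  | root J h => simpa [IsNode, NegDesign.at] using at_nil_ne_omega.2 h
  | sub J u l h => simpa [IsNode, NegDesign.at] using h.isNode

theorem posNode_of_isNode (φ : PosDesign) (u : Occ) (h : IsNode φ.at u) :
    ∃ l, PosNode φ u l := by
  induction φ generalizing u with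
  | omega =>
    rcases u with _ | ⟨a, u⟩ <;> simp [IsNode, PosDesign.at] at h
  | daimon =>
    rcases u with _ | ⟨a, u⟩
    · exact ⟨_, .daimon⟩
    · simp [IsNode, PosDesign.at] at h
  | act ξ I b ih =>
    rcases u with _ | ⟨i | J | _, _ | ⟨i' | J | _, _ | ⟨i'' | J'' | _, u⟩⟩⟩ <;>
      try (simp [IsNode, PosDesign.at] at h; done)
    · exact ⟨_, .root ξ I b⟩
    · by_cases hi : i ∈ I
      · refine ⟨_, .neg ξ I b ⟨i, hi⟩ J (at_nil_ne_omega.1 ?_)⟩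
        simpa [IsNode, PosDesign.at, hi] using h
      · simp [IsNode, PosDesign.at, hi] at h
    · by_cases hi : i ∈ I
      · obtain ⟨l, hl⟩ := ih ⟨i, hi⟩ J u (by simpa [IsNode, PosDesign.at, hi] using h)
        exact ⟨l, .sub ξ I b ⟨i, hi⟩ J u l hl⟩
      · simp [IsNode, PosDesign.at, hi] at h

theorem negNode_of_isNode (ψ : NegDesign) (u : Occ) (h : IsNode ψ.at u) :
    ∃ l, NegNode ψ u l := by
  rcases u with _ | ⟨i' | J | _, _ | ⟨i'' | J'' | _, u⟩⟩ <;>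
    try (simp [IsNode, NegDesign.at] at h; done)
  · refine ⟨_, .root J (at_nil_ne_omega.1 ?_)⟩
    simpa [IsNode, NegDesign.at] using h
  · obtain ⟨l, hl⟩ := posNode_of_isNode (ψ.branch J) u (by simpa [IsNode, NegDesign.at] using h)
    exact ⟨l, .sub J u l hl⟩

theorem mem_actions_pos {φ : PosDesign} {a : Action} :
    a ∈ actions φ.at ↔ ∃ u, PosNode φ u (.action a) := by
  constructor
  · rintro ⟨u, hu, ha⟩
    obtain ⟨l, hl⟩ := posNode_of_isNode φ u hu
    obtain rfl : l = .action a := Option.some.inj (hl.at_eq.symm.trans ha)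
    exact ⟨u, hl⟩
  · rintro ⟨u, hu⟩
    exact ⟨u, hu.isNode, hu.at_eq⟩

theorem mem_actions_neg {ψ : NegDesign} {a : Action} :
    a ∈ actions ψ.at ↔ ∃ u, NegNode ψ u (.action a) := by
  constructor
  · rintro ⟨u, hu, ha⟩
    obtain ⟨l, hl⟩ := negNode_of_isNode ψ u hu
    obtain rfl : l = .action a := Option.some.inj (hl.at_eq.symm.trans ha)
    exact ⟨u, hl⟩
  · rintro ⟨u, hu⟩
    exact ⟨u, hu.isNode, hu.at_eq⟩

/-! ### The tree of nodes -/

/-- The node `v` is the immediate predecessor of the node `w`. -/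
inductive Par (N : Occ → Label → Prop) : Occ → Occ → Prop
  | one {v : Occ} {ζ : Addr} {J : Finset ℕ} {l : Label} (hv : N v (.action (.neg ζ J)))
      (hw : N (v ++ [.one]) l) (hl : l.NotNeg) : Par N v (v ++ [.one])
  | arg {v : Occ} {ζ : Addr} {I J : Finset ℕ} {i : ℕ} (hv : N v (.action (.pos ζ I)))
      (hw : N (v ++ [.idx i, .ram J]) (.action (.neg (ζ ++ [i]) J))) :
      Par N v (v ++ [.idx i, .ram J])

/-- The node `v` is below the node `w`, or equal to it. -/
abbrev Anc (N : Occ → Label → Prop) : Occ → Occ → Prop := Relation.ReflTransGen (Par N)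

theorem Anc.prefix {N : Occ → Label → Prop} {v w : Occ} (h : Anc N v w) : v <+: w := by
  induction h with
  | refl => exact List.prefix_rfl
  | tail _ h ih => cases h <;> exact ih.trans (List.prefix_append _ _)

theorem Anc.append {N M : Occ → Label → Prop} (p : Occ) (hM : ∀ u l, N u l → M (p ++ u) l)
    {v w : Occ} (h : Anc N v w) : Anc M (p ++ v) (p ++ w) := by
  refine Relation.ReflTransGen.lift (p ++ ·) ?_ _ _ h
  rintro v w (⟨hv, hw, hl⟩ | ⟨hv, hw⟩)
  · have := hM _ _ hw
    simp only [Function.onFun, ← List.append_assoc] at this ⊢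
    exact .one (hM _ _ hv) this hl
  · have := hM _ _ hw
    simp only [Function.onFun, ← List.append_assoc] at this ⊢
    exact .arg (hM _ _ hv) this

theorem PosNode.anc {φ : PosDesign} {u : Occ} {l : Label} (h : PosNode φ u l) :
    Anc (PosNode φ) [] u := by
  induction h with
  | daimon => exact .refl
  | root => exact .refl
  | neg ξ I b i J h => exact .single (.arg (v := []) (.root ξ I b) (.neg ξ I b i J h))
  | sub ξ I b i J u l h ih =>
    obtain ⟨l', hl', hn⟩ := posNode_root h.ne_omega
    have h₀ := PosNode.neg ξ I b i J h.ne_omega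
    have h₁ : Par (PosNode (.act ξ I b)) [] [.idx i, .ram J] :=
      .arg (v := []) (.root ξ I b) h₀
    have h₂ : Par (PosNode (.act ξ I b)) [.idx i, .ram J] [.idx i, .ram J, .one] :=
      .one (v := [.idx i, .ram J]) h₀ (.sub ξ I b i J _ _ hl') hn
    exact (Relation.ReflTransGen.single h₁).tail h₂ |>.trans
      (ih.append [.idx i, .ram J, .one] fun u l h => .sub ξ I b i J u l h)

theorem NegNode.anc_of_sub {ψ : NegDesign} {J : Finset ℕ} {u : Occ} {l : Label}
    (h : PosNode (ψ.branch J) u l) : Anc (NegNode ψ) [.ram J] (.ram J :: .one :: u) := by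
  obtain ⟨l', hl', hn⟩ := posNode_root h.ne_omega
  have h₂ : Par (NegNode ψ) [.ram J] [.ram J, .one] :=
    .one (v := [.ram J]) (.root J h.ne_omega) (.sub J _ _ hl') hn
  exact (Relation.ReflTransGen.single h₂).trans
      (h.anc.append [.ram J, .one] fun u l h => .sub J u l h)

theorem NegNode.anc {ψ : NegDesign} {u : Occ} {l : Label} (h : NegNode ψ u l) :
    ∃ J, NegNode ψ [.ram J] (.action (.neg ψ.focus J)) ∧ Anc (NegNode ψ) [.ram J] u := by
  cases h with
  | root J h => exact ⟨J, .root J h, .refl⟩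
  | sub J u l h => exact ⟨J, .root J h.ne_omega, anc_of_sub h⟩

theorem PosNode.son {φ : PosDesign} {u : Occ} {l : Label} (h : PosNode φ u l) {ζ : Addr}
    {J : Finset ℕ} (hl : l = .action (.neg ζ J)) :
    ∃ l, PosNode φ (u ++ [.one]) l ∧ l.NotNeg := by
  induction h with
  | daimon => cases hl
  | root => cases hl
  | neg ξ I b i J h =>
    obtain ⟨l, h, hn⟩ := posNode_root h
    exact ⟨l, .sub ξ I b i J _ _ h, hn⟩
  | sub ξ I b i J u l h ih =>
    obtain ⟨l, h, hn⟩ := ih hl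
    exact ⟨l, .sub ξ I b i J _ _ h, hn⟩

theorem NegNode.son {ψ : NegDesign} {u : Occ} {ζ : Addr} {J : Finset ℕ}
    (h : NegNode ψ u (.action (.neg ζ J))) : ∃ l, NegNode ψ (u ++ [.one]) l ∧ l.NotNeg := by
  cases h with
  | root J h =>
    obtain ⟨l, h, hn⟩ := posNode_root h
    exact ⟨l, .sub J _ _ h, hn⟩
  | sub J u l h =>
    obtain ⟨l, h, hn⟩ := h.son rfl
    exact ⟨l, .sub J _ _ h, hn⟩

/-! ### Consequences of typing -/

theorem mem_starSet {ζ ξ : Addr} {J : Finset ℕ} : ξ ∈ starSet ζ J ↔ ∃ j ∈ J, ζ ++ [j] = ξ := by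
  simp [starSet]

theorem WellFormed.eq_of_prefix {Γ : Finset Addr} (h : WellFormed Γ) {ξ ζ η : Addr} (hξ : ξ ∈ Γ)
    (hζ : ζ ∈ Γ) (h₁ : ξ <+: η) (h₂ : ζ <+: η) : ξ = ζ := by
  by_contra hne
  rcases List.prefix_or_prefix_of_prefix h₁ h₂ with h' | h'
  · exact (h ξ hξ ζ hζ hne).1 h'
  · exact (h ξ hξ ζ hζ hne).2 h'

/-- Every focus extends an address of the base. -/
theorem PosNode.exists_prefix {φ : PosDesign} {u : Occ} {l : Label} (h : PosNode φ u l)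
    {a : Action} (hl : l = .action a) {Γ : Finset Addr} (hΓ : φ.HasBase Γ) :
    ∃ γ ∈ Γ, γ <+: a.focus := by
  induction h generalizing Γ with
  | daimon => cases hl
  | root ξ I b =>
    obtain ⟨Λ, -, rfl, -⟩ := hΓ
    cases hl
    exact ⟨ξ, by simp, List.prefix_rfl⟩
  | neg ξ I b i J h =>
    obtain ⟨Λ, -, rfl, -⟩ := hΓ
    cases hl
    exact ⟨ξ, by simp, List.prefix_append _ _⟩
  | sub ξ I b i J u l h ih =>
    obtain ⟨Λ, -, rfl, -, Λs, hΛs, -, hn⟩ := hΓ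
    obtain ⟨ΛJ, hJ, hb⟩ := (hn i).2.2 J
    obtain ⟨γ, hγ, hp⟩ := ih hl hb
    rcases Finset.mem_union.1 hγ with hγ | hγ
    · obtain ⟨j, -, rfl⟩ := mem_starSet.1 hγ
      exact ⟨ξ, by simp, by simpa using (List.prefix_append ξ [i.1, j]).trans (by simpa using hp)⟩
    · exact ⟨γ, Finset.mem_insert_of_mem (hΛs i (hJ hγ)), hp⟩

theorem NegNode.exists_prefix {ψ : NegDesign} {u : Occ} {a : Action}
    (h : NegNode ψ u (.action a)) {ζ : Addr} {Λ : Finset Addr} (hΛ : ψ.HasBase ζ Λ) :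
    ∃ γ ∈ insert ζ Λ, γ <+: a.focus := by
  obtain ⟨rfl, -, -, hn⟩ := hΛ
  cases h with
  | root J h => exact ⟨ψ.focus, by simp, List.prefix_rfl⟩
  | sub J u l h =>
    obtain ⟨ΛJ, hJ, hb⟩ := hn J
    obtain ⟨γ, hγ, hp⟩ := h.exists_prefix rfl hb
    rcases Finset.mem_union.1 hγ with hγ | hγ
    · obtain ⟨j, -, rfl⟩ := mem_starSet.1 hγ
      exact ⟨ψ.focus, by simp, (List.prefix_append _ _).trans hp⟩
    · exact ⟨γ, Finset.mem_insert_of_mem (hJ hγ), hp⟩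

/-- A positive action is either initial, with its focus in the base, or points to a negative
action. -/
theorem PosNode.pointer {φ : PosDesign} {u : Occ} {l : Label} (h : PosNode φ u l) {ζ : Addr}
    {I : Finset ℕ} (hl : l = .action (.pos ζ I)) {Γ : Finset Addr} (hΓ : φ.HasBase Γ) :
    ζ ∈ Γ ∨ ∃ y ζ' J i, Anc (PosNode φ) y u ∧ PosNode φ y (.action (.neg ζ' J)) ∧
      ζ = ζ' ++ [i] := by
  induction h generalizing Γ with
  | daimon => cases hl
  | root ξ I b =>
    obtain ⟨Λ, -, rfl, -⟩ := hΓ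
    cases hl
    exact .inl (by simp)
  | neg ξ I b i J h => cases hl
  | sub ξ I b i J u l h ih =>
    obtain ⟨Λ, -, rfl, -, Λs, hΛs, -, hn⟩ := hΓ
    obtain ⟨ΛJ, hJ, hb⟩ := (hn i).2.2 J
    have hsub : ∀ u l, PosNode (b i J) u l →
      PosNode (.act ξ I b) ([.idx i, .ram J, .one] ++ u) l := fun u l h => .sub ξ I b i J u l h
    rcases ih hl hb with hζ | ⟨y, ζ', K, k, hy, hN, rfl⟩
    · rcases Finset.mem_union.1 hζ with hζ | hζ
      · obtain ⟨j, -, rfl⟩ := mem_starSet.1 hζ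
        have h₀ := PosNode.neg ξ I b i J h.ne_omega
        obtain ⟨l', hl', hn⟩ := posNode_root h.ne_omega
        exact .inr ⟨_, _, _, j, .head (.one h₀ (.sub ξ I b i J _ _ hl') hn) (h.anc.append _ hsub),
          h₀, rfl⟩
      · exact .inl (Finset.mem_insert_of_mem (hΛs i (hJ hζ)))
    · exact .inr ⟨_, _, _, _, hy.append _ hsub, hsub _ _ hN, rfl⟩

theorem NegNode.pointer {ψ : NegDesign} {u : Occ} {ζ : Addr} {I : Finset ℕ}
    (h : NegNode ψ u (.action (.pos ζ I))) {ξ : Addr} {Λ : Finset Addr} (hΛ : ψ.HasBase ξ Λ) :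
    ζ ∈ Λ ∨ ∃ y ζ' J i, Anc (NegNode ψ) y u ∧ NegNode ψ y (.action (.neg ζ' J)) ∧
      ζ = ζ' ++ [i] := by
  obtain ⟨rfl, -, -, hn⟩ := hΛ
  cases h with
  | sub J u l h =>
    obtain ⟨ΛJ, hJ, hb⟩ := hn J
    rcases h.pointer rfl hb with hζ | ⟨y, ζ', K, k, hy, hN, rfl⟩
    · rcases Finset.mem_union.1 hζ with hζ | hζ
      · obtain ⟨j, -, rfl⟩ := mem_starSet.1 hζ
        exact .inr ⟨_, _, _, j, anc_of_sub h, .root J h.ne_omega, rfl⟩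
      · exact .inl (hJ hζ)
    · exact .inr ⟨_, _, _, _, hy.append [.ram J, .one] fun u l h => .sub J u l h,
        .sub J _ _ hN, rfl⟩

/-! ### Consequences of typing for slices: foci are pairwise distinct -/

/-- Nodes with the same focus are equal. -/
def UniqueFoci (N : Occ → Label → Prop) : Prop :=
  ∀ u v a b, N u (.action a) → N v (.action b) → a.focus = b.focus → u = v

/-- A focus above the root extends either some `ζ j`, so it is longer than `ζ`, or an address of
`Λ`, which is disjoint from `ζ`. -/
theorem NegNode.focus_ne {ψ : NegDesign} {ζ : Addr} {Λ : Finset Addr} (hΛ : ψ.HasBase ζ Λ)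
    {J : Finset ℕ} {u : Occ} {a : Action} (h : PosNode (ψ.branch J) u (.action a)) :
    a.focus ≠ ζ := by
  rintro rfl
  obtain ⟨-, hζ, hw, hn⟩ := hΛ
  obtain ⟨ΛJ, hJ, hb⟩ := hn J
  obtain ⟨γ, hγ, hp⟩ := h.exists_prefix rfl hb
  rcases Finset.mem_union.1 hγ with hγ | hγ
  · obtain ⟨j, -, rfl⟩ := mem_starSet.1 hγ
    simpa using hp.length_le
  · have := hw.eq_of_prefix (Finset.mem_insert_of_mem (hJ hγ)) (Finset.mem_insert_self _ _) hp
      List.prefix_rfl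
    exact hζ (this ▸ hJ hγ)

/-- Different branches may well share foci; the slice condition leaves only one branch to consider.
The hypothesis `ih` lets the lemma serve inside the induction on positive designs. -/
theorem NegNode.uniqueFoci_of_branch {ψ : NegDesign} {ζ : Addr} {Λ : Finset Addr}
    (hΛ : ψ.HasBase ζ Λ) (hs : AtMostOneBranch ψ.branch)
    (ih : ∀ J Γ, (ψ.branch J).HasBase Γ → UniqueFoci (PosNode (ψ.branch J))) :
    UniqueFoci (NegNode ψ) := by
  intro u v a b hu hv hab
  have hf : ψ.focus = ζ := hΛ.1
  cases hu with
  | root J hJ =>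
    cases hv with
    | root K hK => rw [hs J K hJ hK]
    | sub K v _ hv => exact absurd (hab.symm.trans hf) (NegNode.focus_ne hΛ hv)
  | sub J u _ hu =>
    cases hv with
    | root K hK => exact absurd (hab.trans hf) (NegNode.focus_ne hΛ hu)
    | sub K v _ hv =>
      obtain rfl := hs J K hu.ne_omega hv.ne_omega
      obtain ⟨ΛJ, -, hb⟩ := hΛ.2.2.2 J
      rw [ih J _ hb u v a b hu hv hab]

/-- Packaging each family `b i` as a negative design makes the lemmas on `NegNode` available in
inductions on positive designs. -/
theorem PosNode.act_cases {ξ : Addr} {I : Finset ℕ} {b : I → Finset ℕ → PosDesign} {u : Occ}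
    {l : Label} (h : PosNode (.act ξ I b) u l) :
    (u = [] ∧ l = .action (.pos ξ I)) ∨
      ∃ (i : I) (v : Occ), u = .idx i :: v ∧ NegNode ⟨ξ ++ [i.1], b i⟩ v l := by
  cases h with
  | root => exact .inl ⟨rfl, rfl⟩
  | neg _ _ _ i J h => exact .inr ⟨i, _, rfl, .root (ψ := ⟨ξ ++ [i.1], b i⟩) J h⟩
  | sub _ _ _ i J u l h => exact .inr ⟨i, _, rfl, .sub J u l h⟩

theorem posNode_uniqueFoci {φ : PosDesign} (hs : φ.IsSlice) {Γ : Finset Addr}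
    (hΓ : φ.HasBase Γ) : UniqueFoci (PosNode φ) := by
  induction φ generalizing Γ with
  | omega => intro u v a b hu; cases hu
  | daimon => intro u v a b hu; cases hu
  | act ξ I b ih =>
    obtain ⟨Λ, hξ, rfl, hw, Λs, hΛs, hd, hn⟩ := hΓ
    have hbase : ∀ i : I, NegDesign.HasBase ⟨ξ ++ [i.1], b i⟩ (ξ ++ [i.1]) (Λs i) :=
      fun i => ⟨rfl, hn i⟩
    have hroot : ∀ (i : I) v a, NegNode ⟨ξ ++ [i.1], b i⟩ v (.action a) → a.focus ≠ ξ := by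
      rintro i v a hv rfl
      obtain ⟨γ, hγ, hp⟩ := hv.exists_prefix (hbase i)
      rcases Finset.mem_insert.1 hγ with rfl | hγ
      · simpa using hp.length_le
      · have := hw.eq_of_prefix (Finset.mem_insert_of_mem (hΛs i hγ)) (Finset.mem_insert_self _ _)
          hp List.prefix_rfl
        exact hξ (this ▸ hΛs i hγ)
    have hcase : ∀ (i : I) v a, NegNode ⟨ξ ++ [i.1], b i⟩ v (.action a) →
        ξ ++ [i.1] <+: a.focus ∨ ∃ γ ∈ Λs i, γ <+: a.focus := by
      intro i v a hv
      obtain ⟨γ, hγ, hp⟩ := hv.exists_prefix (hbase i)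
      rcases Finset.mem_insert.1 hγ with rfl | hγ
      · exact .inl hp
      · exact .inr ⟨γ, hγ, hp⟩
    have hmix : ∀ (i j : I) (η : Addr), ξ ++ [i.1] <+: η → ∀ γ ∈ Λs j, ¬ γ <+: η := by
      intro i j η h₁ γ hγ h₂
      have := hw.eq_of_prefix (Finset.mem_insert_of_mem (hΛs j hγ)) (Finset.mem_insert_self _ _)
        h₂ ((List.prefix_append ξ [i.1]).trans h₁)
      exact hξ (this ▸ hΛs j hγ)
    intro u₀ v₀ a a' hu₀ hv₀ haa
    rcases hu₀.act_cases with ⟨rfl, h₁⟩ | ⟨i, u, rfl, hu⟩ <;>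
      rcases hv₀.act_cases with ⟨rfl, h₂⟩ | ⟨j, v, rfl, hv⟩
    · rfl
    · cases h₁
      exact absurd haa.symm (hroot j v a' hv)
    · cases h₂
      exact absurd haa (hroot i u a hu)
    -- Foci above different premises differ: each extends `ξ i`, `ξ j` or an address of `Λs i`, `Λs
    -- j`. These are ruled out by length, by well-formedness of the base, or by disjointness of `Λs
    -- i` and `Λs j`.
    · obtain rfl : i = j := by
        by_contra hij
        rcases hcase i u a hu with h₁ | ⟨γ, hγ, h₁⟩ <;> rcases hcase j v a' hv with h₂ | ⟨δ, hδ, h₂⟩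
          <;> rw [← haa] at h₂
        · have := List.prefix_of_prefix_length_le h₁ h₂ (by simp)
          have := this.eq_of_length (by simp)
          exact hij (Subtype.ext (by simpa using this))
        · exact hmix i j _ h₁ δ hδ h₂
        · exact hmix j i _ h₂ γ hγ h₁
        · have := hw.eq_of_prefix (Finset.mem_insert_of_mem (hΛs i hγ))
            (Finset.mem_insert_of_mem (hΛs j hδ)) h₁ h₂
          exact Finset.disjoint_left.1 (hd i j hij) hγ (this ▸ hδ)
      rw [NegNode.uniqueFoci_of_branch (hbase i) (hs i).1 (fun J Γ h => ih i J ((hs i).2 J) h)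
        u v a a' hu hv haa]

theorem negNode_uniqueFoci {ψ : NegDesign} (hs : ψ.IsSlice) {ζ : Addr} {Λ : Finset Addr}
    (hΛ : ψ.HasBase ζ Λ) : UniqueFoci (NegNode ψ) :=
  NegNode.uniqueFoci_of_branch hΛ hs.1 fun J _ h => posNode_uniqueFoci (hs.2 J) h

/-! ### Slices are finite -/

/-- The ramifications range over an infinite set, but at most one of them carries nodes. -/
theorem negNode_finite_of_branch {ψ : NegDesign} (hs : AtMostOneBranch ψ.branch)
    (ih : ∀ J, {u | ∃ l, PosNode (ψ.branch J) u l}.Finite) :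
    {u | ∃ l, NegNode ψ u l}.Finite := by
  have hJ : {J | ψ.branch J ≠ .omega}.Finite :=
    Set.Subsingleton.finite fun J h K h' => hs J K h h'
  refine (hJ.biUnion fun J _ => ((ih J).image fun u => Letter.ram J :: .one :: u).insert
    [.ram J]).subset ?_
  rintro u ⟨l, hu⟩
  cases hu with
  | root J h => exact Set.mem_biUnion h (Set.mem_insert _ _)
  | sub J u _ h => exact Set.mem_biUnion h.ne_omega (Set.mem_insert_of_mem _ ⟨u, ⟨l, h⟩, rfl⟩)

theorem posNode_finite {φ : PosDesign} (hs : φ.IsSlice) : {u | ∃ l, PosNode φ u l}.Finite := by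
  induction φ with
  | omega =>
    refine Set.finite_empty.subset ?_
    rintro u ⟨l, hu⟩
    cases hu
  | daimon =>
    refine (Set.finite_singleton []).subset ?_
    rintro u ⟨l, hu⟩
    cases hu
    rfl
  | act ξ I b ih =>
    have h : ∀ i : I, {u | ∃ l, NegNode ⟨ξ ++ [i.1], b i⟩ u l}.Finite := fun i =>
      negNode_finite_of_branch (hs i).1 fun J => ih i J ((hs i).2 J)
    refine ((Set.finite_iUnion fun i : I => (h i).image (Letter.idx i :: ·)).insert []).subset ?_
    rintro u ⟨l, hu⟩
    rcases hu.act_cases with ⟨rfl, -⟩ | ⟨i, v, rfl, hv⟩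
    · exact Set.mem_insert _ _
    · exact Set.mem_insert_of_mem _ (Set.mem_iUnion.2 ⟨i, v, ⟨l, hv⟩, rfl⟩)

theorem negNode_finite {ψ : NegDesign} (hs : ψ.IsSlice) : {u | ∃ l, NegNode ψ u l}.Finite :=
  negNode_finite_of_branch hs.1 fun J => posNode_finite (hs.2 J)

/-! ### Walks on two opposite trees of nodes -/

/-- What the argument uses of two slices with opposite actions; `false` is the left one. -/
structure Balanced (N : Bool → Occ → Label → Prop) (ξ : Addr) : Prop where
  label_unique : ∀ {s u l l'}, N s u l → N s u l' → l = l'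
  son : ∀ {s u ζ J}, N s u (.action (.neg ζ J)) → ∃ l, N s (u ++ [.one]) l ∧ l.NotNeg
  rootLeft_notNeg : ∀ {l}, N false [] l → l.NotNeg
  ancLeft : ∀ {u l}, N false u l → Anc (N false) [] u
  ancRight : ∀ {u l}, N true u l →
    ∃ J, N true [.ram J] (.action (.neg ξ J)) ∧ Anc (N true) [.ram J] u
  uniqueFoci : ∀ s, UniqueFoci (N s)
  pointer : ∀ {s u ζ I}, N s u (.action (.pos ζ I)) → (s = false ∧ u = [] ∧ ζ = ξ) ∨
    ∃ y ζ' J i, Anc (N s) y u ∧ N s y (.action (.neg ζ' J)) ∧ ζ = ζ' ++ [i]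
  opposite : ∀ {s u a}, N s u (.action a) → ∃ w, N (!s) w (.action a.opposite)
  focus_ne : ∀ {s u a} (i : ℕ), N s u (.action a) → a.focus ++ [i] ≠ ξ
  finite : ∀ s, {u | ∃ l, N s u l}.Finite

/-- `Walk N n s u`: after `n` moves the token may be at the node `u` of the tree `s`, where bindings
are replaced by the requirement that the token jumps between opposite actions. -/
inductive Walk (N : Bool → Occ → Label → Prop) : ℕ → Bool → Occ → Prop
  | start : Walk N 0 false []
  | son {n s u ζ J l} (h : Walk N n s u) (hu : N s u (.action (.neg ζ J)))
      (hl : N s (u ++ [.one]) l) (hn : l.NotNeg) : Walk N (n + 1) s (u ++ [.one])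
  | jump {n s u w ζ J} (h : Walk N n s u) (hu : N s u (.action (.pos ζ J)))
      (hw : N (!s) w (.action (.neg ζ J))) : Walk N (n + 1) (!s) w

namespace Balanced

variable {N : Bool → Occ → Label → Prop} {ξ : Addr}

/-- The token arrives at a negative node from the opposite positive node. -/
theorem walk_neg (hN : Balanced N ξ) {n : ℕ} {s : Bool} {u : Occ} {ζ : Addr} {J : Finset ℕ}
    (h : Walk N n s u) (hu : N s u (.action (.neg ζ J))) :
    ∃ m x, n = m + 1 ∧ Walk N m (!s) x ∧ N (!s) x (.action (.pos ζ J)) := by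
  cases h with
  | start => exact absurd rfl (hN.rootLeft_notNeg hu ζ J)
  | son h _ hl hn => exact absurd (hN.label_unique hl hu) (hn ζ J)
  | @jump m s x w ζ' J' h hx hw =>
    cases hN.label_unique hw hu
    exact ⟨m, x, rfl, by simpa using h, by simpa using hx⟩

/-- Iterates `H` down a path. The bound `n` in `H` allows its use with the induction hypothesis of
`walk_par`. -/
theorem anc_walk {n : ℕ} {s : Bool}
    (H : ∀ m ≤ n, ∀ u p, Walk N m s u → Par (N s) p u → ∃ k < m, Walk N k s p)
    {m : ℕ} (hm : m ≤ n) {y u : Occ} (h : Walk N m s u) (hy : Anc (N s) y u) :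
    y = u ∨ ∃ k < m, Walk N k s y := by
  induction hy generalizing m with
  | refl => exact .inl rfl
  | tail _ hp ih =>
    obtain ⟨k, hk, hw⟩ := H m hm _ _ h hp
    rcases ih (by omega) hw with rfl | ⟨k', hk', hw'⟩
    · exact .inr ⟨k, hk, hw⟩
    · exact .inr ⟨k', by omega, hw'⟩

/-- The walk visits the predecessor of a node before the node. -/
theorem walk_par (hN : Balanced N ξ) (n : ℕ) : ∀ (s : Bool) (u p : Occ), Walk N n s u →
    Par (N s) p u → ∃ m < n, Walk N m s p := by
  induction n using Nat.strong_induction_on with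
  | _ n IH =>
    intro s w p h hp
    cases h with
    | start =>
      generalize hw : ([] : Occ) = w at hp
      cases hp <;> simp at hw
    | @son n s u ζ J l h hu hl hn =>
      generalize hw : u ++ [Letter.one] = w at hp
      cases hp with
      | one => exact ⟨n, by omega, by rwa [← (List.append_cancel_right hw)]⟩
      | arg =>
        have := congrArg List.getLast? hw
        simp at this
    | @jump n s u w ζ J h hu hw =>
      cases hp with
      | one _ hl hn => exact absurd (hN.label_unique hl hw) (hn _ _)
      | @arg ζ₀ I J' i hp hw' =>
        cases hN.label_unique hw hw'
        -- The positive node `u` points to a negative `y` below it, visited earlier by induction.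
        -- The token came to `y` from its opposite, which has the focus of `p` and so is `p`.
        rcases hN.pointer hu with ⟨-, -, h₀⟩ | ⟨y, ζ', K, i', hy, hyN, hζ⟩
        · exact absurd h₀ (hN.focus_ne i hp)
        · obtain ⟨rfl, -⟩ := List.append_inj' hζ rfl
          rcases anc_walk (n := n) (fun m hm => IH m (by omega) s) le_rfl h hy with
            rfl | ⟨k, hk, hyk⟩
          · cases hN.label_unique hu hyN
          · obtain ⟨m, x, rfl, hx, hxN⟩ := hN.walk_neg hyk hyN
            exact ⟨m, by omega, hN.uniqueFoci _ x p _ _ hxN hp rfl ▸ hx⟩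

theorem walk_anc (hN : Balanced N ξ) {n : ℕ} {s : Bool} {y u : Occ} (h : Walk N n s u)
    (hy : Anc (N s) y u) : y = u ∨ ∃ k < n, Walk N k s y :=
  anc_walk (fun m _ => hN.walk_par m s) le_rfl h hy

/-- A jump has a single possible target because foci are unique. Consequently each move adds at most
one negative node to be bound in `exists_run`. -/
theorem walk_unique (hN : Balanced N ξ) {n : ℕ} : ∀ {s s' : Bool} {u u' : Occ}, Walk N n s u →
    Walk N n s' u' → s = s' ∧ u = u' := by
  induction n with
  | zero =>
    intro s s' u u' h h'
    cases h
    cases h'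
    exact ⟨rfl, rfl⟩
  | succ n ih =>
    intro s s' u u' h h'
    cases h with
    | son h hu hl hn =>
      cases h' with
      | son h' _ _ _ =>
        obtain ⟨rfl, rfl⟩ := ih h h'
        exact ⟨rfl, rfl⟩
      | jump h' hu' _ =>
        obtain ⟨rfl, rfl⟩ := ih h h'
        cases hN.label_unique hu hu'
    | jump h hu hw =>
      cases h' with
      | son h' hu' _ _ =>
        obtain ⟨rfl, rfl⟩ := ih h h'
        cases hN.label_unique hu hu'
      | jump h' hu' hw' =>
        obtain ⟨rfl, rfl⟩ := ih h h'
        cases hN.label_unique hu hu'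
        exact ⟨rfl, hN.uniqueFoci _ _ _ _ _ hw hw' rfl⟩

/-- A visited negative node always passes the token to its son, so a path can leave the visited
nodes only above a positive one. -/
theorem exists_first_unvisited {s : Bool} {y x : Occ} (hx : Anc (N s) y x) {n : ℕ}
    (hy : Walk N n s y) (hnx : ∀ m, ¬ Walk N m s x) :
    ∃ (p w : Occ) (m i : ℕ) (ζ : Addr) (I J : Finset ℕ), Anc (N s) y p ∧ Walk N m s p ∧
      w = p ++ [.idx i, .ram J] ∧ N s p (.action (.pos ζ I)) ∧
      N s w (.action (.neg (ζ ++ [i]) J)) ∧ ∀ k, ¬ Walk N k s w := by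
  induction hx with
  | refl => exact absurd hy (hnx n)
  | @tail p w hp hpw ih =>
    by_cases hv : ∀ m, ¬ Walk N m s p
    · exact ih hv
    · push Not at hv
      obtain ⟨m, hm⟩ := hv
      cases hpw with
      | one h hw hl => exact absurd (.son hm h hw hl) (hnx (m + 1))
      | arg h hw => exact ⟨p, _, m, _, _, _, _, hp, hm, rfl, h, hw, hnx⟩

/-- The node `p` is positive and visited, and one of its successors is not visited. -/
def Stuck (N : Bool → Occ → Label → Prop) (q : Bool × Occ) : Prop :=
  ∃ (i : ℕ) (ζ : Addr) (I J : Finset ℕ), (∃ m, Walk N m q.1 q.2) ∧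
    N q.1 q.2 (.action (.pos ζ I)) ∧
    N q.1 (q.2 ++ [.idx i, .ram J]) (.action (.neg (ζ ++ [i]) J)) ∧
    ∀ k, ¬ Walk N k q.1 (q.2 ++ [.idx i, .ram J])

theorem stuck_of_unvisited {s : Bool} {y x : Occ} (hx : Anc (N s) y x) {n : ℕ}
    (hy : Walk N n s y) (hnx : ∀ m, ¬ Walk N m s x) : ∃ p, Anc (N s) y p ∧ Stuck N (s, p) := by
  obtain ⟨p, w, m, i, ζ, I, J, h₁, h₂, rfl, h₃, h₄, h₅⟩ := exists_first_unvisited hx hy hnx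
  exact ⟨p, h₁, i, ζ, I, J, ⟨m, h₂⟩, h₃, h₄, h₅⟩

/-- From a node where the walk is stuck one finds another one, visited strictly later. -/
theorem exists_later_stuck (hN : Balanced N ξ) {q : Bool × Occ} (hq : Stuck N q) :
    ∃ q', Stuck N q' ∧ ∀ n', Walk N n' q'.1 q'.2 → ∃ n < n', Walk N n q.1 q.2 := by
  obtain ⟨s, v⟩ := q
  obtain ⟨i, ζ, I, J, ⟨n, hn⟩, hv, hw, hnw⟩ := hq
  dsimp only at hn hv hw hnw ⊢
  obtain ⟨x, hx⟩ := hN.opposite hw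
  have hnx : ∀ m, ¬ Walk N m (!s) x := fun m hm =>
    hnw (m + 1) (by simpa using Walk.jump hm hx (by simpa using hw))
  rcases hN.pointer hx with ⟨-, -, h₀⟩ | ⟨y, ζ', K, k, hyx, hy, hζ⟩
  · exact absurd h₀ (hN.focus_ne i hv)
  obtain ⟨rfl, -⟩ := List.append_inj' hζ rfl
  obtain ⟨v', hv'⟩ := hN.opposite hy
  simp only [Action.opposite, Bool.not_not] at hv'
  obtain rfl := hN.uniqueFoci _ _ _ _ _ hv' hv rfl
  have hyw : Walk N (n + 1) (!s) y := .jump hn hv' hy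
  obtain ⟨p, hyp, hp⟩ := stuck_of_unvisited hyx hyw hnx
  refine ⟨(!s, p), hp, fun n' hn' => ?_⟩
  -- Any visit of `p` follows a visit of `y`, which itself comes one move after a visit of `v'`. The
  -- case `p = y` is excluded by the signs.
  rcases hN.walk_anc hn' hyp with rfl | ⟨m, hm, hym⟩
  · obtain ⟨_, _, _, _, -, hpos, -⟩ := hp
    cases hN.label_unique hpos hy
  · obtain ⟨m', z, rfl, hz, hzN⟩ := hN.walk_neg hym hy
    simp only [Bool.not_not] at hz hzN
    exact ⟨m', by omega, hN.uniqueFoci _ _ _ _ _ hzN hv' rfl ▸ hz⟩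

theorem not_stuck (hN : Balanced N ξ) (q : Bool × Occ) : ¬ Stuck N q := by
  intro hq
  have hfin : {q | Stuck N q}.Finite := by
    refine (Set.finite_iUnion fun s => (hN.finite s).image (Prod.mk s)).subset ?_
    rintro ⟨s, v⟩ ⟨i, ζ, I, J, -, hv, -⟩
    exact Set.mem_iUnion.2 ⟨s, v, ⟨_, hv⟩, rfl⟩
  -- The time of the first visit; the value `sInf ∅ = 0` never matters, since stuck nodes are
  -- visited.
  let τ : Bool × Occ → ℕ := fun q => sInf {n | Walk N n q.1 q.2}
  obtain ⟨q, hq, hmax⟩ := Set.exists_max_image _ τ hfin ⟨q, hq⟩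
  obtain ⟨q', hq', hlt⟩ := hN.exists_later_stuck hq
  have hne : {n | Walk N n q'.1 q'.2}.Nonempty := by
    obtain ⟨_, _, _, _, h, -⟩ := hq'
    exact h
  obtain ⟨n, hn, hw⟩ := hlt _ (Nat.sInf_mem hne)
  have h₁ : τ q' ≤ τ q := hmax q' hq'
  have h₂ : τ q ≤ n := Nat.sInf_le hw
  exact absurd hn (not_lt.2 (h₁.trans h₂))

/-- The walk visits all nodes. -/
theorem exists_walk (hN : Balanced N ξ) {s : Bool} {u : Occ} {l : Label} (hu : N s u l) :
    ∃ n, Walk N n s u := by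
  by_contra hnu
  push Not at hnu
  obtain ⟨y, n, hyu, hy⟩ : ∃ y n, Anc (N s) y u ∧ Walk N n s y := by
    cases s with
    | false => exact ⟨[], 0, hN.ancLeft hu, .start⟩
    | true =>
      obtain ⟨J, hr, hJ⟩ := hN.ancRight hu
      -- The opposite of the root of the right tree has focus `ξ`, so it is the root of the left
      -- tree, and the first move is a jump between them.
      obtain ⟨x, hx⟩ := hN.opposite hr
      rcases hN.pointer hx with ⟨-, rfl, -⟩ | ⟨y, ζ', K, k, -, hy, hζ⟩
      · exact ⟨_, 1, hJ, .jump .start hx hr⟩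
      · exact absurd hζ.symm (hN.focus_ne k hy)
  obtain ⟨p, -, hp⟩ := stuck_of_unvisited hyu hy hnu
  exact hN.not_stuck _ hp

end Balanced

/-! ### The token machine follows the walk -/

/-- The labelled nodes of the two designs. -/
def Nodes (φ : PosDesign) (ψ : NegDesign) : Bool → Occ → Label → Prop
  | false => PosNode φ
  | true => NegNode ψ

def Token.mk : Bool → Occ → Token
  | false => .L
  | true => .R

/-- The binding of an occurrence of one side with an occurrence of the other side. -/
def bound : Bool → Occ → Occ → Occ × Occ
  | false, u, v => (u, v)
  | true, u, v => (v, u)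

theorem bound_not (s : Bool) (u v : Occ) : bound (!s) u v = bound s v u := by
  cases s <;> rfl

variable {φ : PosDesign} {ψ : NegDesign}

theorem Step.neg {s : Bool} {u : Occ} {ζ : Addr} {J : Finset ℕ} (B : Set (Occ × Occ))
    (hu : Nodes φ ψ s u (.action (.neg ζ J))) :
    Step φ ψ ⟨.mk s u, B⟩ ⟨.mk s (u ++ [.one]), B⟩ := by
  cases s with
  | false => exact .negL B u ζ J (PosNode.at_eq hu)
  | true => exact .negR B u ζ J (NegNode.at_eq hu)

theorem Step.pos {s : Bool} {u v v' : Occ} {ζ : Addr} {i : ℕ} {I J : Finset ℕ}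
    {B : Set (Occ × Occ)} (hu : Nodes φ ψ s u (.action (.pos (ζ ++ [i]) I)))
    (hv : Nodes φ ψ s v (.action (.neg ζ J))) (hp : v <+: u) (hne : v ≠ u)
    (hB : bound s v v' ∈ B) :
    Step φ ψ ⟨.mk s u, B⟩ ⟨.mk (!s) (v' ++ [.idx i, .ram I]),
      insert (bound s u (v' ++ [.idx i, .ram I])) B⟩ := by
  cases s with
  | false =>
    exact .posL B u v v' ζ i I (PosNode.at_eq hu)
      ⟨hp, hne, _, _, i, PosNode.at_eq hu, PosNode.at_eq hv, rfl⟩ hB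
  | true =>
    exact .posR B u v v' ζ i I (NegNode.at_eq hu)
      ⟨hp, hne, _, _, i, NegNode.at_eq hu, NegNode.at_eq hv, rfl⟩ hB

/-- The machine reaches the positions of the walk, with all visited negative nodes bound. -/
theorem Balanced.exists_run (hN : Balanced (Nodes φ ψ) ψ.focus) {n : ℕ} : ∀ {s : Bool} {u : Occ},
    Walk (Nodes φ ψ) n s u →
    ∃ B, Relation.ReflTransGen (Step φ ψ) ⟨.L [], ∅⟩ ⟨.mk s u, B⟩ ∧
      ∀ m ≤ n, ∀ s' c ζ J, Walk (Nodes φ ψ) m s' c → Nodes φ ψ s' c (.action (.neg ζ J)) →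
        ∃ c', bound s' c c' ∈ B ∧ Nodes φ ψ (!s') c' (.action (.pos ζ J)) := by
  induction n with
  | zero =>
    intro s u h
    cases h
    refine ⟨∅, .refl, fun m hm s' c ζ J hc hcN => ?_⟩
    obtain ⟨k, -, rfl, -⟩ := hN.walk_neg hc hcN
    omega
  | succ n ih =>
    intro s w h
    have h' := h
    cases h' with
    | @son _ _ u _ _ _ hu huN hl hnn =>
      obtain ⟨B, hr, hB⟩ := ih hu
      refine ⟨B, hr.tail (.neg B huN), fun m hm s' c ζ J hc hcN => ?_⟩
      rcases Nat.le_succ_iff.1 hm with hm | rfl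
      · exact hB m hm s' c ζ J hc hcN
      · obtain ⟨rfl, rfl⟩ := hN.walk_unique h hc
        exact absurd (hN.label_unique hl hcN) (hnn ζ J)
    | @jump _ s u w ζ J hu huN hw =>
      obtain ⟨B, hr, hB⟩ := ih hu
      have key : Step φ ψ ⟨.mk s u, B⟩ ⟨.mk (!s) w, insert (bound s u w) B⟩ := by
        -- The target `w` either has a predecessor, and the move is `posL` or `posR`, or is the root
        -- of `ψ`, and the move is `start`.
        have hpar : (∃ p, Par (Nodes φ ψ (!s)) p w) ∨ (s = false ∧ w = [.ram J] ∧ ζ = ψ.focus) := by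
          cases s with
          | false =>
            obtain ⟨K, hK, hKw⟩ := hN.ancRight hw
            rcases Relation.ReflTransGen.cases_tail hKw with rfl | ⟨p, -, hp⟩
            · cases hN.label_unique hK hw
              exact .inr ⟨rfl, rfl, rfl⟩
            · exact .inl ⟨p, hp⟩
          | true =>
            rcases Relation.ReflTransGen.cases_tail (hN.ancLeft hw) with rfl | ⟨p, -, hp⟩
            · exact absurd rfl (hN.rootLeft_notNeg hw ζ J)
            · exact .inl ⟨p, hp⟩
        rcases hN.pointer huN with ⟨rfl, rfl, rfl⟩ | ⟨y, ζ', K, i, hyu, hy, rfl⟩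
        · rcases hpar with ⟨p, hp⟩ | ⟨-, rfl, -⟩
          · cases hp with
            | one _ hl hnn => exact absurd (hN.label_unique hl hw) (hnn _ _)
            | @arg ζ₀ I J' i hp hw' =>
              have := hN.label_unique hw hw'
              simp only [Label.action.injEq, Action.neg.injEq] at this
              exact absurd this.1.symm (hN.focus_ne i hp)
          · exact .start B J (PosNode.at_eq huN)
        · rcases hpar with ⟨p, hp⟩ | ⟨-, -, h₀⟩
          · cases hp with
            | one _ hl hnn => exact absurd (hN.label_unique hl hw) (hnn _ _)
            | @arg ζ₀ I J' i' hp hw' =>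
              have := hN.label_unique hw hw'
              simp only [Label.action.injEq, Action.neg.injEq] at this
              obtain ⟨hζ, rfl⟩ := this
              obtain ⟨rfl, hi⟩ := List.append_inj' hζ rfl
              obtain rfl : i = i' := by simpa using hi
              have hne : y ≠ u := by
                rintro rfl
                cases hN.label_unique hy huN
              obtain ⟨k, hk, hyk⟩ := (hN.walk_anc hu hyu).resolve_left hne
              obtain ⟨c', hc', hcN⟩ := hB k hk.le s y _ _ hyk hy
              -- The node bound to `y` has the focus of the predecessor `p` of `w`, so it is `p`,
              -- and the machine moves exactly to `w`.
              obtain rfl := hN.uniqueFoci _ _ _ _ _ hcN hp rfl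
              exact .pos huN hy hyu.prefix hne hc'
          · exact absurd h₀ (hN.focus_ne i hy)
      refine ⟨_, hr.tail key, fun m hm s' c ζ' J' hc hcN => ?_⟩
      rcases Nat.le_succ_iff.1 hm with hm | rfl
      · obtain ⟨c', hc', hcN'⟩ := hB m hm s' c ζ' J' hc hcN
        exact ⟨c', Set.mem_insert_of_mem _ hc', hcN'⟩
      · obtain ⟨rfl, rfl⟩ := hN.walk_unique h hc
        cases hN.label_unique hw hcN
        exact ⟨u, by simp [bound_not], by simpa using huN⟩

/-! ### Opposite slices are balanced -/

theorem nodes_balanced {ξ : Addr} {Λ₁ Λ₂ : Finset Addr}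
    (hΛ : ∀ a ∈ Λ₁, ∀ b ∈ Λ₂, AddrDisjoint a b)
    (hφ : φ.IsDesign (insert ξ Λ₁)) (hψ : ψ.IsDesign ξ Λ₂)
    (hφs : φ.IsSlice) (hψs : ψ.IsSlice)
    (hbal : actions ψ.at = Action.opposite '' actions φ.at) :
    Balanced (Nodes φ ψ) ξ := by
  have hfocus : ψ.focus = ξ := hψ.1
  have hwf₂ : WellFormed (insert ξ Λ₂) := hψ.2.2.1
  have hwf₁ : WellFormed (insert ξ Λ₁) := by
    have := hφ.2
    cases φ with
    | omega => exact this
    | daimon => exact this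
    | act ζ I b =>
      obtain ⟨Λ, -, -, h, -⟩ := this
      exact h
  have hinv : ∀ a : Action, a.opposite.opposite = a := fun a => by cases a <;> rfl
  have hfoc : ∀ a : Action, a.opposite.focus = a.focus := fun a => by cases a <;> rfl
  have hopp : ∀ {s u a}, Nodes φ ψ s u (.action a) →
      ∃ w, Nodes φ ψ (!s) w (.action a.opposite) := by
    intro s u a h
    cases s with
    | false =>
      have : a.opposite ∈ actions ψ.at := hbal ▸ ⟨a, mem_actions_pos.2 ⟨u, h⟩, rfl⟩
      exact mem_actions_neg.1 this
    | true =>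
      have : a ∈ actions ψ.at := mem_actions_neg.2 ⟨u, h⟩
      rw [hbal] at this
      obtain ⟨b, hb, rfl⟩ := this
      rw [hinv]
      exact mem_actions_pos.1 hb
  -- An action and its opposite share a focus, which extends an address of each base. Addresses of
  -- `Λ₁` and `Λ₂` are never comparable, so one of the two is `ξ`. Thus no action has its focus in
  -- `Λ₁` or `Λ₂`.
  have hprefix : ∀ {s u a}, Nodes φ ψ s u (.action a) → ξ <+: a.focus := by
    have hL : ∀ {u a}, PosNode φ u (.action a) → ξ <+: a.focus := by
      intro u a h
      obtain ⟨w, hw⟩ := hopp (s := false) h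
      obtain ⟨γ, hγ, hp⟩ := PosNode.exists_prefix h rfl hφ.2
      obtain ⟨δ, hδ, hp'⟩ := NegNode.exists_prefix hw hψ
      rw [hfoc] at hp'
      rcases Finset.mem_insert.1 hγ with rfl | hγ
      · exact hp
      rcases Finset.mem_insert.1 hδ with rfl | hδ
      · exact hp'
      rcases List.prefix_or_prefix_of_prefix hp hp' with h | h
      · exact absurd h (hΛ γ hγ δ hδ).1
      · exact absurd h (hΛ γ hγ δ hδ).2
    intro s u a h
    cases s with
    | false => exact hL h
    | true =>
      obtain ⟨w, hw⟩ := hopp h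
      exact hfoc a ▸ hL hw
  have hne : ∀ {s u a} (i : ℕ), Nodes φ ψ s u (.action a) → a.focus ++ [i] ≠ ξ := by
    intro s u a i h h'
    have := (hprefix h).length_le
    simp [← h'] at this
  refine ⟨?_, ?_, ?_, ?_, ?_, ?_, ?_, hopp, hne, ?_⟩
  · intro s u l l' h h'
    cases s with
    | false => exact Option.some.inj ((PosNode.at_eq h).symm.trans (PosNode.at_eq h'))
    | true => exact Option.some.inj ((NegNode.at_eq h).symm.trans (NegNode.at_eq h'))
  · intro s u ζ J h
    cases s with
    | false => exact PosNode.son h rfl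
    | true => exact NegNode.son h
  · exact fun h => PosNode.notNeg_of_nil h
  · exact fun h => PosNode.anc h
  · subst hfocus
    exact fun h => NegNode.anc h
  · rintro (_ | _)
    · exact posNode_uniqueFoci hφs hφ.2
    · exact negNode_uniqueFoci hψs hψ
  · intro s u ζ I h
    have hξζ : ξ <+: ζ := hprefix h
    cases s with
    | false =>
      rcases PosNode.pointer h rfl hφ.2 with hζ | hy
      -- An initial positive action has focus `ξ`. So does the root of `φ`, hence they are the same
      -- node.
      · obtain rfl := hwf₁.eq_of_prefix (Finset.mem_insert_self _ _) hζ hξζ List.prefix_rfl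
        refine .inl ⟨rfl, ?_, rfl⟩
        cases φ with
        | omega => cases h
        | daimon => cases h
        | act ζ' I' b =>
          obtain ⟨Λ, -, hΓ, -⟩ := hφ.2
          have h₀ := PosNode.root ζ' I' b
          have hξζ' : ξ <+: ζ' := hprefix (s := false) h₀
          obtain rfl := hwf₁.eq_of_prefix (Finset.mem_insert_self _ _)
            (hΓ ▸ Finset.mem_insert_self ζ' Λ) hξζ' List.prefix_rfl
          exact posNode_uniqueFoci hφs hφ.2 _ _ _ _ h h₀ rfl
      · exact .inr hy
    | true =>
      rcases NegNode.pointer h hψ with hζ | hy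
      · obtain rfl := hwf₂.eq_of_prefix (Finset.mem_insert_self _ _)
          (Finset.mem_insert_of_mem hζ) hξζ List.prefix_rfl
        exact absurd hζ hψ.2.1
      · exact .inr hy
  · rintro (_ | _)
    · exact posNode_finite hφs
    · exact negNode_finite hψs

end Ludics

theorem mainTheorem10 (ξ : Ludics.Addr) (Λ₁ Λ₂ : Finset Ludics.Addr)
    (hΛ : ∀ a ∈ Λ₁, ∀ b ∈ Λ₂, Ludics.AddrDisjoint a b)
    (φ : Ludics.PosDesign) (ψ : Ludics.NegDesign)
    (hφ : φ.IsDesign (insert ξ Λ₁)) (hψ : ψ.IsDesign ξ Λ₂)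
    (hφs : φ.IsSlice) (hψs : ψ.IsSlice)
    (hbal : Ludics.actions ψ.at = Ludics.Action.opposite '' Ludics.actions φ.at) :
    (∀ u, Ludics.IsNode φ.at u → Ludics.Visits φ ψ (.L u)) ∧
      (∀ u, Ludics.IsNode ψ.at u → Ludics.Visits φ ψ (.R u)) := by
  have hN := Ludics.nodes_balanced hΛ hφ hψ hφs hψs hbal
  have hrun : ∀ s u l, Ludics.Nodes φ ψ s u l → Ludics.Visits φ ψ (.mk s u) := by
    intro s u l h
    obtain ⟨n, hn⟩ := hN.exists_walk h
    obtain rfl : ψ.focus = ξ := hψ.1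
    obtain ⟨B, hB, -⟩ := hN.exists_run hn
    exact ⟨B, hB⟩
  refine ⟨fun u hu => ?_, fun u hu => ?_⟩
  · obtain ⟨l, hl⟩ := Ludics.posNode_of_isNode φ u hu
    exact hrun false u l hl
  · obtain ⟨l, hl⟩ := Ludics.negNode_of_isNode ψ u hu
    exact hrun true u l hl
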